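/- For every $n\in\mathbb N$ there is a family $(N_m)_{m\ge 1}$ of finite high-level Petri nets in the class $\mathcal N_F$, where $N_m$ has the set of colors $\{0,\dots,m\}$ and a single initial marking, such that the following two statements hold. (The class $\mathcal N_F$ consists of the finite high-level Petri nets that are safe, i.e. every reachable marking puts at most one color on every place, that have finitely many reachable markings, and whose guards are written in a decidable theory with the color set as domain of discourse. The nets are moreover assumed to be ordinary: at most one arc connects any two nodes in either direction.) 1. There is a $k\in\mathbb N$ such that for all $m\ge 1$ the following holds. There is an adequate order on the finite configurations of the symbolic unfolding of $N_m$. For every such adequate order $\prec$, the generalized Esparza–Römer–Vogler (ERV) algorithm, applied to $N_m$, always terminates with a result, and every possible result has exactly $k$ nodes (conditions and events, the auxiliary initial event $\bot$ not being counted). So the number of nodes does not depend on $m$. This algorithm starts from the initial conditions. It repeatedly picks a possible extension $e$ of the current prefix whose cone configuration $[e]$ (the set of causal predecessors of $e$, with $e$ itself) is $\prec$-minimal. If $[e]$ contains no cut-off event found earlier, it adds $e$ and its output conditions and recomputes the possible extensions; otherwise it discards $e$. It stops when no possible extension is left. An added event $e$ is a cut-off event if every marking represented by $[e]$ is represented by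 $[e']$ for some event $e'$ of the current prefix with $[e']\prec[e]$. 2. For all $m\ge 1$ the following holds. Let $E_m$ be the expansion of $N_m$, i.e. the P/T net with places $p.c$ ($p$ a place and $c$ a color of $N_m$) and transitions $t.\sigma$ ($t$ a transition of $N_m$ and $\sigma$ a firing mode of $t$). There is an adequate order on the finite configurations of the low-level unfolding of $E_m$. For every such adequate order $\prec$, the original ERV algorithm, applied to $E_m$, always terminates with a result, and every possible result is a finite prefix with more than $m^n$ nodes. This is the same algorithm, but $e$ is a cut-off event if some event $e'$ of the current prefix with $[e']\prec[e]$ has the same marking, $\mathrm{Mark}([e'])=\mathrm{Mark}([e])$. -/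

import Mathlib

namespace PetriUnf

/-- A finite high-level Petri net with colour set `C`. The flow function is split into `pre` (arcs
from places to transitions) and `post` (arcs from transitions to places). The guard of `t` is a
predicate on the assignments of colours to the variables that occur on arcs at `t`. -/
structure HLNet (C : Type) where
  Var : Type
  Place : Type
  Trans : Type
  finVar : Finite Var
  finPlace : Finite Place
  finTrans : Finite Trans
  pre : Place → Var → Trans → ℕ
  post : Trans → Var → Place → ℕ
  guard : (t : Trans) → ({v : Var // ∃ p, 1 ≤ pre p v t ∨ 1 ≤ post t v p} → C) → Prop
  init : Set (Place → C → ℕ)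
  init_nonempty : init.Nonempty
  init_same : ∀ M ∈ init, ∀ M' ∈ init, ∀ p, ∑ᶠ c, M p c = ∑ᶠ c, M' p c

attribute [instance] HLNet.finVar HLNet.finPlace HLNet.finTrans

variable {C : Type}

namespace HLNet

/-- The variables on arcs at `t`. -/
abbrev Vars (N : HLNet C) (t : N.Trans) : Type :=
  {v : N.Var // ∃ p, 1 ≤ N.pre p v t ∨ 1 ≤ N.post t v p}

/-- A marking: how often each colour lies on each place. -/
abbrev Marking (N : HLNet C) : Type := N.Place → C → ℕ

/-- The firing modes of `t`. -/
abbrev Mode (N : HLNet C) (t : N.Trans) : Type := {σ : N.Vars t → C // N.guard t σ}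

/-- The multiset of tokens consumed by `t` under the assignment `σ`. -/
noncomputable def preMark (N : HLNet C) (t : N.Trans) (σ : N.Vars t → C) : N.Marking :=
  fun p c => ∑ᶠ (v : N.Vars t) (_ : σ v = c), N.pre p v t

/-- The multiset of tokens produced by `t` under the assignment `σ`. -/
noncomputable def postMark (N : HLNet C) (t : N.Trans) (σ : N.Vars t → C) : N.Marking :=
  fun p c => ∑ᶠ (v : N.Vars t) (_ : σ v = c), N.post t v p

/-- `M [t,σ⟩ M'`. -/
def Fires (N : HLNet C) (t : N.Trans) (σ : N.Mode t) (M M' : N.Marking) : Prop :=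
  (∀ p c, N.preMark t σ.1 p c ≤ M p c) ∧
    ∀ p c, M' p c = M p c - N.preMark t σ.1 p c + N.postMark t σ.1 p c

/-- The reachable markings. -/
inductive Reachable (N : HLNet C) : N.Marking → Prop
  | init (M : N.Marking) : M ∈ N.init → Reachable N M
  | step (M M' : N.Marking) (t : N.Trans) (σ : N.Mode t) :
      Reachable N M → N.Fires t σ M M' → Reachable N M'

/-- At most one arc connects any two nodes in either direction. -/
def Ordinary (N : HLNet C) : Prop :=
  (∀ p t, ∑ᶠ v, N.pre p v t ≤ 1) ∧ ∀ t p, ∑ᶠ v, N.post t v p ≤ 1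

/-- Every reachable marking puts at most one colour on every place. -/
def Safe (N : HLNet C) : Prop :=
  ∀ M, N.Reachable M → ∀ p, ∑ᶠ c, M p c ≤ 1

/-- The class `N_F` for a finite colour set: finite (built into `HLNet`), safe nets, without loss of
generality ordinary, with finitely many reachable markings, whose guards are written in a decidable
theory with domain of discourse `C`. The theory is here the first-order theory of `C` with equality
and a constant for every colour. As `C` is finite, it is decidable, and every predicate on colours
can be written in it, so no other theory would allow more guards. -/
structure IsNF [Finite C] (N : HLNet C) : Prop where
  ordinary : N.Ordinary
  safe : N.Safe
  guards : ∀ t, letI := FirstOrder.Language.emptyStructure (M := C)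
    (Set.univ : Set C).Definable FirstOrder.Language.empty {σ | N.guard t σ}
  finite_reachable : {M | N.Reachable M}.Finite

/-! ### Nodes of unfoldings

The net is assumed to be ordinary and safe. A condition is an initially marked place, or is given by
the event that produces it and the arc on which it is produced. An event is given by its transition
and the set of pairs (condition, variable) that it consumes; as the net is ordinary, this set is a
function on the arcs leading to the transition. -/

/-- The arcs that lead to `t`. -/
abbrev PreArc (N : HLNet C) (t : N.Trans) : Type :=
  {a : N.Place × N.Var // 1 ≤ N.pre a.1 a.2 t}

/-- The arcs that leave `t`. -/
abbrev PostArc (N : HLNet C) (t : N.Trans) : Type :=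
  {a : N.Var × N.Place // 1 ≤ N.post t a.1 a.2}

/-- The variable on an arc to `t`. -/
def preVar (N : HLNet C) {t : N.Trans} (a : N.PreArc t) : N.Vars t :=
  ⟨a.1.2, a.1.1, Or.inl a.2⟩

/-- The variable on an arc from `t`. -/
def postVar (N : HLNet C) {t : N.Trans} (a : N.PostArc t) : N.Vars t :=
  ⟨a.1.1, a.1.2, Or.inr a.2⟩

/-- Conditions: `init p` is produced by the special initial event `⊥`; `post t X a` is produced, on
the arc `a` leaving `t`, by the event with transition `t` that consumes the conditions `X`. -/
inductive Cond (N : HLNet C) : Type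
  | init (p : N.Place) : Cond N
  | post (t : N.Trans) (X : N.PreArc t → Cond N) (a : N.PostArc t) : Cond N

/-- Events. -/
structure Event (N : HLNet C) : Type where
  trans : N.Trans
  pre : N.PreArc trans → N.Cond

/-- The condition that the event `e` produces on the arc `a`. -/
def Event.out {N : HLNet C} (e : N.Event) (a : N.PostArc e.trans) : N.Cond :=
  Cond.post e.trans e.pre a

/-- The label of a condition. -/
def Cond.label {N : HLNet C} : N.Cond → N.Place
  | Cond.init p => p
  | Cond.post _ _ a => a.1.2

/-- The pairs (condition, variable) consumed by `e`. -/
def Event.preset {N : HLNet C} (e : N.Event) : Set (N.Cond × N.Var) :=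
  Set.range fun a => (e.pre a, a.1.2)

/-- The pairs (condition, variable) produced by `e`. -/
def Event.postset {N : HLNet C} (e : N.Event) : Set (N.Cond × N.Var) :=
  Set.range fun a => (e.out a, a.1.1)

/-- Nodes: conditions and events. -/
abbrev Node (N : HLNet C) : Type := N.Cond ⊕ N.Event

/-- The relation `→` on nodes. -/
inductive Flow (N : HLNet C) : N.Node → N.Node → Prop
  | consume (e : N.Event) (a : N.PreArc e.trans) : Flow N (Sum.inl (e.pre a)) (Sum.inr e)
  | produce (e : N.Event) (a : N.PostArc e.trans) : Flow N (Sum.inr e) (Sum.inl (e.out a))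

/-- Causality `≤`. -/
def Le (N : HLNet C) : N.Node → N.Node → Prop := Relation.ReflTransGen N.Flow

/-- Strict causality `<`. -/
def Lt (N : HLNet C) : N.Node → N.Node → Prop := Relation.TransGen N.Flow

/-- Structural conflict. -/
def Conflict (N : HLNet C) (x y : N.Node) : Prop :=
  ∃ (b : N.Cond) (e e' : N.Event), e ≠ e' ∧ N.Flow (Sum.inl b) (Sum.inr e) ∧
    N.Flow (Sum.inl b) (Sum.inr e') ∧ N.Le (Sum.inr e) x ∧ N.Le (Sum.inr e') y

/-- The set `[e]` of causal predecessors of `e`, `e` included. -/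
def cone (N : HLNet C) (e : N.Event) : Set N.Event := {e' | N.Le (Sum.inr e') (Sum.inr e)}

/-! ### Predicates -/

/-- A valuation of the indexed variables: one variable for every initial condition, and
one copy of the variables of `e` for every event `e`. -/
structure Valuation (N : HLNet C) : Type where
  bot : N.Place → C
  mode : (e : N.Event) → N.Vars e.trans → C

/-- The value of the variable through which a condition gets its colour. -/
def Valuation.color {N : HLNet C} (θ : N.Valuation) : N.Cond → C
  | Cond.init p => θ.bot p
  | Cond.post t X a => θ.mode ⟨t, X⟩ (N.postVar a)

/-- The predicate of `⊥`. -/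
def PredBot (N : HLNet C) (θ : N.Valuation) : Prop :=
  ∃ M ∈ N.init, ∀ p c, 1 ≤ M p c → θ.bot p = c

/-- The local predicate of an event. -/
def LocPred (N : HLNet C) (θ : N.Valuation) (e : N.Event) : Prop :=
  N.guard e.trans (θ.mode e) ∧ ∀ a, θ.mode e (N.preVar a) = θ.color (e.pre a)

/-- The predicate of an event. -/
def Pred (N : HLNet C) (θ : N.Valuation) (e : N.Event) : Prop :=
  N.PredBot θ ∧ ∀ e' ∈ N.cone e, N.LocPred θ e'

/-- The predicate of the event (or `⊥`) that produces a condition. -/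
def PredCond (N : HLNet C) (θ : N.Valuation) : N.Cond → Prop
  | Cond.init _ => N.PredBot θ
  | Cond.post t X _ => N.Pred θ ⟨t, X⟩

/-- Color conflict of a set of nodes: the predicates are not jointly satisfiable. -/
def ColorConflict (N : HLNet C) (S : Set N.Node) : Prop :=
  ¬ ∃ θ : N.Valuation, (∀ e, Sum.inr e ∈ S → N.Pred θ e) ∧ ∀ b, Sum.inl b ∈ S → N.PredCond θ b

/-- A set of concurrent conditions. -/
def IsCoSet (N : HLNet C) (B : Set N.Cond) : Prop :=
  ¬ N.ColorConflict (Sum.inl '' B) ∧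
    ∀ b ∈ B, ∀ b' ∈ B, ¬ N.Lt (Sum.inl b) (Sum.inl b') ∧ ¬ N.Conflict (Sum.inl b) (Sum.inl b')

/-- The initial conditions, one for each initially marked place. -/
def initConds (N : HLNet C) : Set N.Cond :=
  {b | ∃ p, (∃ M ∈ N.init, ∃ c, 1 ≤ M p c) ∧ b = Cond.init p}

/-- The conditions on a pair of a transition and a set of consumed conditions to be an event: it
consumes a co-set whose labels fit the arcs of the transition, and its predicate is satisfiable. -/
def Fits (N : HLNet C) (e : N.Event) : Prop :=
  (∀ a, (e.pre a).label = a.1.1) ∧ N.IsCoSet (Set.range e.pre) ∧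
    ∃ θ : N.Valuation, N.LocPred θ e ∧ ∀ a, N.PredCond θ (e.pre a)

/-! ### The symbolic unfolding -/

/-- Sets of conditions and events, used for prefixes of the unfolding. -/
structure Prefix (N : HLNet C) : Type where
  conds : Set N.Cond
  events : Set N.Event

/-- The number of nodes. -/
noncomputable def Prefix.size {N : HLNet C} (β : N.Prefix) : ℕ∞ :=
  β.conds.encard + β.events.encard

/-- Possible extensions. -/
def possExt (N : HLNet C) (β : N.Prefix) : Set N.Event :=
  {e | (∀ a, e.pre a ∈ β.conds) ∧ N.Fits e ∧ e ∉ β.events}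

/-- The nodes obtained from the initial conditions by repeatedly attaching possible extensions,
together with the conditions they produce. -/
inductive InUnfolding (N : HLNet C) : N.Node → Prop
  | init (b : N.Cond) : b ∈ N.initConds → InUnfolding N (Sum.inl b)
  | event (e : N.Event) : (∀ a, InUnfolding N (Sum.inl (e.pre a))) → N.Fits e →
      InUnfolding N (Sum.inr e)
  | cond (e : N.Event) (a : N.PostArc e.trans) : InUnfolding N (Sum.inr e) →
      InUnfolding N (Sum.inl (e.out a))

/-- The symbolic unfolding, that is, the maximal symbolic branching process. -/
def unfolding (N : HLNet C) : N.Prefix where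
  conds := {b | N.InUnfolding (Sum.inl b)}
  events := {e | N.InUnfolding (Sum.inr e)}

/-! ### Configurations -/

/-- Configurations of the symbolic unfolding. -/
def IsConfig (N : HLNet C) (S : Set N.Event) : Prop :=
  S ⊆ N.unfolding.events ∧ (∀ e ∈ S, ∀ e' ∈ S, ¬ N.Conflict (Sum.inr e) (Sum.inr e')) ∧
    ¬ N.ColorConflict (Sum.inr '' S) ∧ ∀ e ∈ S, N.cone e ⊆ S

/-- Finite configurations. -/
abbrev FinConfig (N : HLNet C) : Type := {S : Set N.Event // S.Finite ∧ N.IsConfig S}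

/-- The conditions consumed by events in `S`. -/
def consumed (N : HLNet C) (S : Set N.Event) : Set N.Cond := {b | ∃ e ∈ S, ∃ a, b = e.pre a}

/-- The conditions produced by events in `S`. -/
def produced (N : HLNet C) (S : Set N.Event) : Set N.Cond := {b | ∃ e ∈ S, ∃ a, b = e.out a}

/-- The conditions occupied after an execution of `S`. -/
def cut (N : HLNet C) (S : Set N.Event) : Set N.Cond :=
  (N.initConds ∪ N.produced S) \ N.consumed S

/-- Instantiations of a configuration; only the values on the variables of `⊥` and of the events
in `S` matter. -/
def IsInst (N : HLNet C) (S : Set N.Event) (θ : N.Valuation) : Prop :=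
  N.PredBot θ ∧ ∀ e ∈ S, N.Pred θ e

/-- The marking of an instantiated configuration. -/
noncomputable def markOf (N : HLNet C) (S : Set N.Event) (θ : N.Valuation) : N.Marking :=
  fun p c => {b ∈ N.cut S | b.label = p ∧ θ.color b = c}.ncard

/-- The markings represented by a configuration. -/
def marks (N : HLNet C) (S : Set N.Event) : Set N.Marking :=
  {M | ∃ θ, N.IsInst S θ ∧ N.markOf S θ = M}

/-- The nodes of the future `⇑S` of a configuration. -/
def future (N : HLNet C) (S : Set N.Event) : N.Prefix where
  conds := {b ∈ N.unfolding.conds | b ∉ N.consumed S ∧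
    (∀ y ∈ S, ¬ N.Conflict (Sum.inr y) (Sum.inl b)) ∧
    ¬ N.ColorConflict (insert (Sum.inl b) (Sum.inr '' S))}
  events := {e ∈ N.unfolding.events | e ∉ S ∧
    (∀ y ∈ S, ¬ N.Conflict (Sum.inr y) (Sum.inr e)) ∧
    ¬ N.ColorConflict (insert (Sum.inr e) (Sum.inr '' S))}

/-- The nodes of the occurrence net around `D`, starting from the cut of `S`. -/
def around (N : HLNet C) (S D : Set N.Event) : N.Prefix where
  conds := N.cut S ∪ N.consumed D ∪ N.produced D
  events := D

/-- A map on conditions and a map on events. -/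
structure NodeMap (N : HLNet C) : Type where
  onCond : N.Cond → N.Cond
  onEvent : N.Event → N.Event

/-- `φ` restricts to an injective homomorphism from `β` to `β'` that preserves labels (hence
guards). For injective maps the multiset images of presets and postsets are set images. -/
structure NodeMap.IsMono {N : HLNet C} (φ : N.NodeMap) (β β' : N.Prefix) : Prop where
  mapsCond : Set.MapsTo φ.onCond β.conds β'.conds
  mapsEvent : Set.MapsTo φ.onEvent β.events β'.events
  injCond : Set.InjOn φ.onCond β.conds
  injEvent : Set.InjOn φ.onEvent β.events
  label : ∀ b ∈ β.conds, (φ.onCond b).label = b.label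
  trans : ∀ e ∈ β.events, (φ.onEvent e).trans = e.trans
  preset : ∀ e ∈ β.events, (φ.onEvent e).preset = (Prod.map φ.onCond id) '' e.preset
  postset : ∀ e ∈ β.events, (φ.onEvent e).postset = (Prod.map φ.onCond id) '' e.postset

/-- `φ` restricts to a label-preserving isomorphism from `β` to `β'`. -/
def NodeMap.IsIso {N : HLNet C} (φ : N.NodeMap) (β β' : N.Prefix) : Prop :=
  φ.IsMono β β' ∧ φ.onCond '' β.conds = β'.conds ∧ φ.onEvent '' β.events = β'.events

/-- Adequate orders on the finite configurations of the symbolic unfolding. In the last clause, `S₁'`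
is a finite extension of `S₁` by `D`, and `S₂'` is the extension of `S₂` by the image of `D` under
the (for safe nets unique) monomorphism. -/
structure IsAdequate (N : HLNet C) (r : N.FinConfig → N.FinConfig → Prop) : Prop where
  strict : IsStrictOrder N.FinConfig r
  wf : WellFounded r
  subset : ∀ S₁ S₂ : N.FinConfig, S₁.1 ⊂ S₂.1 → r S₁ S₂
  ext : ∀ (S₁ S₂ S₁' S₂' : N.FinConfig) (D : Set N.Event) (φ : N.NodeMap),
    Disjoint S₁.1 D → S₁'.1 = S₁.1 ∪ D →
    (∃ M ∈ N.marks S₁.1 ∩ N.marks S₂.1, ∃ θ, N.IsInst (S₁.1 ∪ D) θ ∧ N.markOf S₁.1 θ = M) →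
    φ.IsMono (N.around S₁.1 D) (N.future S₂.1) → φ.onCond '' N.cut S₁.1 = N.cut S₂.1 →
    S₂'.1 = S₂.1 ∪ φ.onEvent '' D →
    r S₁ S₂ → r S₁' S₂'

/-! ### The algorithm -/

/-- The order `r`, read on sets of events. -/
def Prec (N : HLNet C) (r : N.FinConfig → N.FinConfig → Prop) (S S' : Set N.Event) : Prop :=
  ∃ h h', r ⟨S, h⟩ ⟨S', h'⟩

/-- `e` is a cut-off event in `β`: every marking represented by `[e]` is represented by `[e']` for
some event `e'` of `β` with `[e'] ≺ [e]`. -/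
def IsCutoff (N : HLNet C) (r : N.FinConfig → N.FinConfig → Prop) (β : N.Prefix)
    (e : N.Event) : Prop :=
  N.marks (N.cone e) ⊆ {M | ∃ e' ∈ β.events, N.Prec r (N.cone e') (N.cone e) ∧
    M ∈ N.marks (N.cone e')}

/-- The variables of the algorithm: the prefix under construction, the current set of possible
extensions, and the set of cut-off events found so far. -/
structure State (N : HLNet C) : Type where
  fin : N.Prefix
  pe : Set N.Event
  cutoff : Set N.Event

/-- The state before the loop. -/
def start (N : HLNet C) : N.State where
  fin := ⟨N.initConds, ∅⟩
  pe := N.possExt ⟨N.initConds, ∅⟩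
  cutoff := ∅

/-- Adding the event `e` and the conditions it produces. -/
def Prefix.add {N : HLNet C} (β : N.Prefix) (e : N.Event) : N.Prefix where
  conds := β.conds ∪ Set.range e.out
  events := insert e β.events

/-- One pass through the loop, for the order `r` and the cut-off criterion `crit`. -/
inductive Step (N : HLNet C) (r : N.FinConfig → N.FinConfig → Prop)
    (crit : N.Prefix → N.Event → Prop) : N.State → N.State → Prop
  | add (s : N.State) (e : N.Event) : e ∈ s.pe →
      (∀ e' ∈ s.pe, ¬ N.Prec r (N.cone e') (N.cone e)) → N.cone e ∩ s.cutoff = ∅ →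
      Step N r crit s ⟨s.fin.add e, N.possExt (s.fin.add e),
        s.cutoff ∪ {e' | e' = e ∧ crit (s.fin.add e) e}⟩
  | skip (s : N.State) (e : N.Event) : e ∈ s.pe →
      (∀ e' ∈ s.pe, ¬ N.Prec r (N.cone e') (N.cone e)) → (N.cone e ∩ s.cutoff).Nonempty →
      Step N r crit s ⟨s.fin, s.pe \ {e}, s.cutoff⟩

/-- No run is infinite. -/
def Terminates (N : HLNet C) (r : N.FinConfig → N.FinConfig → Prop)
    (crit : N.Prefix → N.Event → Prop) : Prop :=
  ¬ ∃ s : ℕ → N.State, s 0 = N.start ∧ ∀ i, N.Step r crit (s i) (s (i + 1))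

/-- `β` is the result of a run: the prefix in a state without possible extensions. -/
def IsOutput (N : HLNet C) (r : N.FinConfig → N.FinConfig → Prop)
    (crit : N.Prefix → N.Event → Prop) (β : N.Prefix) : Prop :=
  ∃ s, Relation.ReflTransGen (N.Step r crit) N.start s ∧ s.pe = ∅ ∧ s.fin = β

/-! ### P/T nets and expansions

P/T nets are the high-level nets with one colour, one variable, and guards `true`. For them all
predicates are satisfiable, and the unfolding above is the low-level unfolding. -/

/-- The expansion of a net with the single initial marking `M₀`, a P/T net. -/
noncomputable def expansion [Finite C] (N : HLNet C) (M₀ : N.Marking) : HLNet Unit where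
  Var := Unit
  Place := N.Place × C
  Trans := Σ t : N.Trans, N.Mode t
  finVar := inferInstance
  finPlace := inferInstance
  finTrans := inferInstance
  pre := fun p _ t => N.preMark t.1 t.2.1 p.1 p.2
  post := fun t _ p => N.postMark t.1 t.2.1 p.1 p.2
  guard := fun _ _ => True
  init := {fun p _ => M₀ p.1 p.2}
  init_nonempty := Set.singleton_nonempty _
  init_same := by
    rintro M rfl M' rfl p
    rfl

/-- The marking of a configuration of the unfolding of a P/T net. -/
noncomputable def markPT (N : HLNet Unit) (S : Set N.Event) : N.Place → ℕ :=
  fun p => {b ∈ N.cut S | b.label = p}.ncard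

/-- Adequate orders on the finite configurations of the unfolding of a P/T net, in the original form:
the order is preserved along the (for safe nets unique) isomorphism between the futures of two
configurations with the same marking. -/
structure IsAdequatePT (N : HLNet Unit) (r : N.FinConfig → N.FinConfig → Prop) : Prop where
  strict : IsStrictOrder N.FinConfig r
  wf : WellFounded r
  subset : ∀ S₁ S₂ : N.FinConfig, S₁.1 ⊂ S₂.1 → r S₁ S₂
  ext : ∀ (S₁ S₂ S₁' S₂' : N.FinConfig) (D : Set N.Event) (φ : N.NodeMap),
    Disjoint S₁.1 D → S₁'.1 = S₁.1 ∪ D →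
    N.markPT S₁.1 = N.markPT S₂.1 →
    φ.IsIso (N.future S₁.1) (N.future S₂.1) →
    S₂'.1 = S₂.1 ∪ φ.onEvent '' D →
    r S₁ S₂ → r S₁' S₂'

/-- The original cut-off criterion: some `[e']` in `β` with `[e'] ≺ [e]` has the marking of `[e]`. -/
def IsCutoffPT (N : HLNet Unit) (r : N.FinConfig → N.FinConfig → Prop) (β : N.Prefix)
    (e : N.Event) : Prop :=
  ∃ e' ∈ β.events, N.Prec r (N.cone e') (N.cone e) ∧
    N.markPT (N.cone e') = N.markPT (N.cone e)

end HLNet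

end PetriUnf

/-! The witness `choiceNet` has one transition, which consumes the only initial token (on the place
`none`) and puts a token of arbitrary colour on each of `n` further places. Symbolically this is one
event: one initial condition, one event and `n` output conditions, so `n + 2` nodes whatever the
number of colours. In the expansion each choice of `n` output colours is a transition of its own
that consumes the same initial token, which gives `(m + 1) ^ n` pairwise distinct events.

The quantification over all adequate orders costs nothing, because both nets are `Shallow`: a
produced token can never be consumed. Every event then consumes initial conditions only, and its
cone is the event alone. A cut-off event suppresses only later events that have it in their cones,
so on a shallow net cut-offs suppress nothing. Each pass of the algorithm adds one of the finitely
many `initEvents`, and every result is the prefix made of all of them (`Shallow.terminates`,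
`Shallow.eq_of_isOutput`), for every order and every cut-off criterion. Well-foundedness of the
order is needed only to find a minimal possible extension, hence for the existence of a result
(`Shallow.exists_isOutput`).

Adequate orders exist because comparison by number of events is adequate on any net, in both senses.
-/

namespace PetriUnf

namespace HLNet

variable {C : Type}

/-! ### The order by cardinality is adequate -/

/-- Comparison of finite configurations by the number of their events. -/
def cardLT (N : HLNet C) (S S' : N.FinConfig) : Prop := S.1.ncard < S'.1.ncard

theorem cardLT_strict (N : HLNet C) : IsStrictOrder N.FinConfig N.cardLT where
  irrefl _ := lt_irrefl _
  trans _ _ _ := lt_trans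

theorem cardLT_wf (N : HLNet C) : WellFounded N.cardLT :=
  InvImage.wf (fun S : N.FinConfig => S.1.ncard) Nat.lt_wfRel.wf

theorem cardLT_of_ssubset (N : HLNet C) (S₁ S₂ : N.FinConfig) (h : S₁.1 ⊂ S₂.1) :
    N.cardLT S₁ S₂ :=
  Set.ncard_lt_ncard h S₂.2.1

/-- Both configurations grow by the same number of events: `f` is injective on `D`, and events in
the future of `S₂` lie outside `S₂`. The hypotheses are weak enough to serve both notions of
adequacy. -/
theorem cardLT_ext (N : HLNet C) {S₁ S₂ S₁' S₂' : N.FinConfig} {D : Set N.Event}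
    {f : N.Event → N.Event} (hD : Disjoint S₁.1 D) (h₁ : S₁'.1 = S₁.1 ∪ D)
    (hf : Set.InjOn f D) (hS₂ : Set.MapsTo f D (N.future S₂.1).events)
    (h₂ : S₂'.1 = S₂.1 ∪ f '' D) (h : N.cardLT S₁ S₂) : N.cardLT S₁' S₂' := by
  have hDfin : D.Finite := S₁'.2.1.subset (h₁ ▸ Set.subset_union_right)
  have hdisj : Disjoint S₂.1 (f '' D) := by
    rw [Set.disjoint_left]
    rintro _ he ⟨d, hd, rfl⟩
    exact (hS₂ hd).2.1 he
  unfold cardLT at *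
  rw [h₁, h₂, Set.ncard_union_eq hD S₁.2.1 hDfin,
    Set.ncard_union_eq hdisj S₂.2.1 (hDfin.image f), hf.ncard_image]
  omega

theorem ColorConflict.mono {N : HLNet C} {S T : Set N.Node} (h : N.ColorConflict S) (hST : S ⊆ T) :
    N.ColorConflict T := fun ⟨θ, he, hb⟩ =>
  h ⟨θ, fun e h => he e (hST h), fun b h => hb b (hST h)⟩

/-- Needed for P/T adequacy, where the isomorphism is controlled only on futures. Freedom from both
kinds of conflict passes from the large configuration to its parts. -/
theorem IsConfig.subset_future {N : HLNet C} {S S' D : Set N.Event} (h : N.IsConfig S')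
    (hD : Disjoint S D) (hS' : S' = S ∪ D) : D ⊆ (N.future S).events := by
  subst hS'
  intro e he
  refine ⟨h.1 (Or.inr he), fun h' => Set.disjoint_left.1 hD h' he,
    fun y hy => h.2.1 y (Or.inl hy) e (Or.inr he), fun hc => h.2.2.1 (hc.mono ?_)⟩
  rintro _ (rfl | ⟨y, hy, rfl⟩)
  · exact ⟨e, Or.inr he, rfl⟩
  · exact ⟨y, Or.inl hy, rfl⟩

theorem isAdequate_cardLT (N : HLNet C) : N.IsAdequate N.cardLT where
  strict := N.cardLT_strict
  wf := N.cardLT_wf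
  subset := N.cardLT_of_ssubset
  ext _ _ _ _ _ _ hD h₁ _ hφ _ h₂ h := N.cardLT_ext hD h₁ hφ.injEvent hφ.mapsEvent h₂ h

theorem isAdequatePT_cardLT (N : HLNet Unit) : N.IsAdequatePT N.cardLT where
  strict := N.cardLT_strict
  wf := N.cardLT_wf
  subset := N.cardLT_of_ssubset
  ext _ _ S₁' _ _ _ hD h₁ _ hφ h₂ h :=
    have hsub := S₁'.2.2.subset_future hD h₁
    N.cardLT_ext hD h₁ (hφ.1.injEvent.mono hsub) (hφ.1.mapsEvent.mono_left hsub) h₂ h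

/-! ### Nets in which no produced token is ever consumed -/

/-- No place has both an incoming and an outgoing arc. -/
def Shallow (N : HLNet C) : Prop :=
  ∀ t v p t' v', 1 ≤ N.post t v p → ¬ 1 ≤ N.pre p v' t'

/-- The events that consume initial conditions only. -/
def initEvents (N : HLNet C) : Set N.Event := {e | (∀ a, e.pre a ∈ N.initConds) ∧ N.Fits e}

theorem not_flow_init (N : HLNet C) (x : N.Node) (p : N.Place) :
    ¬ N.Flow x (Sum.inl (Cond.init p)) := by
  rintro ⟨⟩

theorem not_lt_init (N : HLNet C) (x : N.Node) (p : N.Place) :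
    ¬ N.Lt x (Sum.inl (Cond.init p)) := fun h => by
  obtain ⟨y, -, hy⟩ := Relation.TransGen.tail'_iff.1 h
  exact N.not_flow_init y p hy

theorem eq_of_le_init (N : HLNet C) {x : N.Node} {p : N.Place}
    (h : N.Le x (Sum.inl (Cond.init p))) : x = Sum.inl (Cond.init p) := by
  rcases Relation.ReflTransGen.cases_tail h with h | ⟨y, -, hy⟩
  · exact h.symm
  · exact (N.not_flow_init y p hy).elim

/-- Nothing flows into an initial condition, so a causal chain ending in `e` cannot start at another
event. -/
theorem cone_of_mem_initEvents {N : HLNet C} {e : N.Event} (he : e ∈ N.initEvents) :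
    N.cone e = {e} := by
  ext e'
  refine ⟨fun h => ?_, fun h => h ▸ Relation.ReflTransGen.refl⟩
  rcases Relation.ReflTransGen.cases_tail h with h | ⟨y, hy, hf⟩
  · exact (Sum.inr_injective h).symm
  · cases hf with
    | consume _ a =>
      obtain ⟨p, -, hp⟩ := he.1 a
      rw [hp] at hy
      exact absurd (N.eq_of_le_init hy) Sum.inr_ne_inl

/-- Initial conditions have no predecessors, hence are neither ordered nor in conflict, and the
predicate of each is that of `⊥`. One valuation therefore settles both absence of color conflict and
satisfiability. -/
theorem fits_of_initConds {N : HLNet C} {e : N.Event} (hinit : ∀ a, e.pre a ∈ N.initConds)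
    (hlabel : ∀ a, (e.pre a).label = a.1.1)
    (hθ : ∃ θ : N.Valuation, N.PredBot θ ∧ N.LocPred θ e) : N.Fits e := by
  obtain ⟨θ, hbot, hloc⟩ := hθ
  have hpred : ∀ a, N.PredCond θ (e.pre a) := fun a => by
    obtain ⟨p, -, hp⟩ := hinit a
    rw [hp]
    exact hbot
  refine ⟨hlabel, ⟨fun hc => hc ⟨θ, ?_, ?_⟩, ?_⟩, θ, hloc, hpred⟩
  · rintro e ⟨b, -, hb⟩
    exact absurd hb Sum.inl_ne_inr
  · rintro b ⟨_, ⟨a, rfl⟩, hb⟩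
    exact Sum.inl_injective hb ▸ hpred a
  · rintro b ⟨a, rfl⟩ b' ⟨a', rfl⟩
    obtain ⟨p, -, hp⟩ := hinit a
    obtain ⟨p', -, hp'⟩ := hinit a'
    rw [hp, hp']
    refine ⟨N.not_lt_init _ _, ?_⟩
    rintro ⟨-, e₁, -, -, -, -, he₁, -⟩
    exact absurd (N.eq_of_le_init he₁) Sum.inr_ne_inl

/-- Such an event is determined by its transition: the labels force each arc to consume the initial
condition of its own place. -/
theorem initEvents_finite (N : HLNet C) : N.initEvents.Finite := by
  refine (Set.finite_range fun t : N.Trans =>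
    (⟨t, fun a => Cond.init a.1.1⟩ : N.Event)).subset ?_
  rintro ⟨t, X⟩ ⟨hinit, hlabel, -⟩
  refine ⟨t, ?_⟩
  refine congrArg (Event.mk t) (funext fun a => ?_)
  obtain ⟨p, -, hp⟩ := hinit a
  have := hlabel a
  change X a = _ at hp
  change (X a).label = _ at this
  rw [hp] at this ⊢
  exact congrArg Cond.init this.symm

theorem initConds_finite (N : HLNet C) : N.initConds.Finite :=
  (Set.finite_range Cond.init).subset fun _ ⟨p, _, hb⟩ => ⟨p, hb.symm⟩

theorem produced_finite (N : HLNet C) {S : Set N.Event} (hS : S.Finite) :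
    (N.produced S).Finite := by
  have : N.produced S = ⋃ e ∈ S, Set.range e.out := by
    ext b
    simp only [produced, Set.mem_ofPred_eq, Set.mem_iUnion, Set.mem_range, exists_prop, eq_comm]
  rw [this]
  exact hS.biUnion fun e _ => Set.finite_range e.out

/-- The prefix that consists of the initial conditions, the events in `S` and their output. -/
def prefixOf (N : HLNet C) (S : Set N.Event) : N.Prefix := ⟨N.initConds ∪ N.produced S, S⟩

theorem prefixOf_empty (N : HLNet C) : N.prefixOf ∅ = ⟨N.initConds, ∅⟩ := by
  simp [prefixOf, produced]

theorem prefixOf_add (N : HLNet C) (S : Set N.Event) (e : N.Event) :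
    (N.prefixOf S).add e = N.prefixOf (insert e S) := by
  unfold prefixOf Prefix.add
  congr 1
  ext b
  simp only [produced, Set.mem_union, Set.mem_ofPred_eq, Set.mem_range, Set.mem_insert_iff,
    exists_eq_or_imp, eq_comm (a := b)]
  rw [or_assoc]
  exact or_congr Iff.rfl or_comm

/-! ### The algorithm on shallow nets -/

theorem Shallow.possExt_prefixOf {N : HLNet C} (hN : N.Shallow) (S : Set N.Event) :
    N.possExt (N.prefixOf S) = N.initEvents \ S := by
  ext e
  refine ⟨fun ⟨hpre, hfits, he⟩ => ⟨⟨fun a => ?_, hfits⟩, he⟩,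
    fun ⟨⟨hpre, hfits⟩, he⟩ => ⟨fun a => Or.inl (hpre a), hfits, he⟩⟩
  rcases hpre a with h | ⟨e', -, a', ha'⟩
  · exact h
  -- A produced condition lies on a place with an incoming arc; consuming it would require an
  -- outgoing arc as well.
  · have hlabel := hfits.1 a
    rw [ha'] at hlabel
    exact (hN _ _ _ _ _ a'.2 (hlabel ▸ a.2)).elim

/-- The shape of the states reached by the algorithm on a shallow net. -/
structure IsRegular (N : HLNet C) (s : N.State) : Prop where
  fin : s.fin = N.prefixOf s.fin.events
  pe : s.pe = N.initEvents \ s.fin.events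
  events : s.fin.events ⊆ N.initEvents
  cutoff : s.cutoff ⊆ s.fin.events

theorem Shallow.isRegular_start {N : HLNet C} (hN : N.Shallow) : N.IsRegular N.start where
  fin := N.prefixOf_empty.symm
  pe := by
    change N.possExt ⟨N.initConds, ∅⟩ = _
    rw [← prefixOf_empty, hN.possExt_prefixOf]
    rfl
  events := Set.empty_subset _
  cutoff := Set.empty_subset _

/-- `P` stands for the verdict of the cut-off criterion, which has no influence on the invariant. -/
theorem Shallow.isRegular_add {N : HLNet C} (hN : N.Shallow) {s : N.State} (hs : N.IsRegular s)
    {e : N.Event} (he : e ∈ s.pe) (P : Prop) :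
    N.IsRegular ⟨s.fin.add e, N.possExt (s.fin.add e), s.cutoff ∪ {e' | e' = e ∧ P}⟩ where
  fin := by
    change s.fin.add e = N.prefixOf (insert e s.fin.events)
    rw [← prefixOf_add, ← hs.fin]
  pe := by
    change N.possExt (s.fin.add e) = N.initEvents \ insert e s.fin.events
    rw [hs.fin, prefixOf_add, hN.possExt_prefixOf]
    rfl
  events := Set.insert_subset (hs.pe ▸ he).1 hs.events
  cutoff := Set.union_subset (hs.cutoff.trans (Set.subset_insert _ _)) fun _ h => Or.inl h.1

/-- Cut-off events have already been added, whereas the cone of a possible extension is just that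
new event. So no event is ever discarded. -/
theorem IsRegular.cone_inter_cutoff {N : HLNet C} {s : N.State} (hs : N.IsRegular s)
    {e : N.Event} (he : e ∈ s.pe) : N.cone e ∩ s.cutoff = ∅ := by
  rw [hs.pe] at he
  rw [cone_of_mem_initEvents he.1, Set.singleton_inter_eq_empty]
  exact fun h => he.2 (hs.cutoff h)

/-- The number of possible extensions is the termination measure; the `skip` case is impossible. -/
theorem Shallow.isRegular_step {N : HLNet C} (hN : N.Shallow)
    {r : N.FinConfig → N.FinConfig → Prop} {crit : N.Prefix → N.Event → Prop} {s s' : N.State}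
    (hs : N.IsRegular s) (h : N.Step r crit s s') :
    N.IsRegular s' ∧ s'.pe.ncard < s.pe.ncard := by
  cases h with
  | add e he _ _ =>
    refine ⟨hN.isRegular_add hs he _, ?_⟩
    rw [(hN.isRegular_add hs he (crit (s.fin.add e) e)).pe]
    refine Set.ncard_lt_ncard ?_ (hs.pe ▸ N.initEvents_finite.subset Set.sdiff_subset)
    refine (Set.ssubset_iff_of_subset ?_).2 ⟨e, he, fun h => h.2 (Set.mem_insert _ _)⟩
    rw [hs.pe]
    exact Set.sdiff_subset_sdiff_right (Set.subset_insert _ _)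
  | skip e he _ hne =>
    exact absurd (hs.cone_inter_cutoff he) hne.ne_empty

theorem wellFounded_prec (N : HLNet C) {r : N.FinConfig → N.FinConfig → Prop}
    (hr : WellFounded r) : WellFounded (N.Prec r) := by
  have key : ∀ S : N.FinConfig, Acc (N.Prec r) S.1 := fun S => by
    induction S using hr.induction with
    | _ S ih => exact ⟨_, fun S' ⟨h, _, hr'⟩ => ih ⟨S', h⟩ hr'⟩
  -- An arbitrary set need not be a finite configuration, but all its predecessors under `Prec` are.
  exact ⟨fun S => ⟨_, fun S' ⟨h, _, _⟩ => key ⟨S', h⟩⟩⟩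

theorem Shallow.terminates {N : HLNet C} (hN : N.Shallow) (r : N.FinConfig → N.FinConfig → Prop)
    (crit : N.Prefix → N.Event → Prop) : N.Terminates r crit := by
  rintro ⟨s, h0, hs⟩
  have hreg : ∀ i, N.IsRegular (s i) := fun i => by
    induction i with
    | zero => exact h0 ▸ hN.isRegular_start
    | succ i ih => exact (hN.isRegular_step ih (hs i)).1
  exact not_strictAnti_of_wellFoundedLT (fun i => (s i).pe.ncard)
    (strictAnti_nat_of_succ_lt fun i => (hN.isRegular_step (hreg i) (hs i)).2)

theorem Shallow.exists_run {N : HLNet C} (hN : N.Shallow) {r : N.FinConfig → N.FinConfig → Prop}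
    (hr : WellFounded r) (crit : N.Prefix → N.Event → Prop) (s : N.State) (hs : N.IsRegular s) :
    ∃ s', Relation.ReflTransGen (N.Step r crit) s s' ∧ s'.pe = ∅ := by
  induction hk : s.pe.ncard using Nat.strong_induction_on generalizing s with
  | _ k ih =>
    rcases s.pe.eq_empty_or_nonempty with hpe | hpe
    · exact ⟨s, .refl, hpe⟩
    · obtain ⟨e, he, hmin⟩ := (InvImage.wf N.cone (N.wellFounded_prec hr)).has_min s.pe hpe
      have hstep : N.Step r crit s _ := .add s e he hmin (hs.cone_inter_cutoff he)
      obtain ⟨hs', hlt⟩ := hN.isRegular_step hs hstep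
      obtain ⟨s', hrun, hs'⟩ := ih _ (hk ▸ hlt) _ hs' rfl
      exact ⟨s', .head hstep hrun, hs'⟩

theorem Shallow.exists_isOutput {N : HLNet C} (hN : N.Shallow)
    {r : N.FinConfig → N.FinConfig → Prop} (hr : WellFounded r)
    (crit : N.Prefix → N.Event → Prop) : ∃ β, N.IsOutput r crit β := by
  obtain ⟨s, hrun, hpe⟩ := hN.exists_run hr crit N.start hN.isRegular_start
  exact ⟨s.fin, s, hrun, hpe, rfl⟩

/-- A regular state without possible extensions has exhausted `initEvents`, so the result depends
neither on the run nor on the order. -/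
theorem Shallow.eq_of_isOutput {N : HLNet C} (hN : N.Shallow)
    {r : N.FinConfig → N.FinConfig → Prop} {crit : N.Prefix → N.Event → Prop} {β : N.Prefix}
    (h : N.IsOutput r crit β) : β = N.prefixOf N.initEvents := by
  obtain ⟨s, hrun, hpe, rfl⟩ := h
  have hs : N.IsRegular s := by
    clear hpe
    induction hrun with
    | refl => exact hN.isRegular_start
    | tail _ hstep ih => exact (hN.isRegular_step ih hstep).1
  rw [hs.fin, hs.events.antisymm (Set.sdiff_eq_empty.1 (hs.pe ▸ hpe))]

theorem size_prefixOf_initEvents_lt_top (N : HLNet C) : (N.prefixOf N.initEvents).size < ⊤ :=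
  WithTop.add_lt_top.2 ⟨(N.initConds_finite.union
    (N.produced_finite N.initEvents_finite)).encard_lt_top, N.initEvents_finite.encard_lt_top⟩

/-! ### The expansion -/

theorem exists_one_le_of_finsum {α : Type*} {P : α → Prop} {f : α → ℕ}
    (h : 1 ≤ ∑ᶠ (a : α) (_ : P a), f a) : ∃ a, 1 ≤ f a := by
  by_contra! hf
  have hzero : ∀ a, f a = 0 := fun a => Nat.lt_one_iff.1 (hf a)
  simp [hzero] at h

/-- An arc of the expansion at `(p, c)` can only come from an arc of the original net at `p`. -/
theorem expansion_shallow [Finite C] {N : HLNet C} (hN : N.Shallow) (M₀ : N.Marking) :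
    (N.expansion M₀).Shallow := by
  rintro ⟨t, σ⟩ v ⟨p, c⟩ ⟨t', σ'⟩ v' hpost hpre
  obtain ⟨w, hw⟩ := exists_one_le_of_finsum hpost
  obtain ⟨w', hw'⟩ := exists_one_le_of_finsum hpre
  exact hN t w p t' w' hw hw'

/-- A firing mode that only consumes initially marked tokens gives an event of the unfolding of the
expansion. -/
theorem expansion_mem_initEvents [Finite C] (N : HLNet C) (M₀ : N.Marking) (t : N.Trans)
    (σ : N.Mode t) (h : ∀ p c, 1 ≤ N.preMark t σ.1 p c → 1 ≤ M₀ p c) :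
    (⟨⟨t, σ⟩, fun a => Cond.init a.1.1⟩ : (N.expansion M₀).Event) ∈
      (N.expansion M₀).initEvents := by
  have hinit : ∀ a : (N.expansion M₀).PreArc ⟨t, σ⟩,
      (Cond.init a.1.1 : (N.expansion M₀).Cond) ∈ (N.expansion M₀).initConds := fun a =>
    ⟨a.1.1, ⟨_, rfl, (), h _ _ a.2⟩, rfl⟩
  exact ⟨hinit, fits_of_initConds hinit (fun _ => rfl)
    ⟨⟨fun _ => (), fun _ _ => ()⟩, ⟨_, rfl, fun _ _ _ => rfl⟩, trivial, fun _ => rfl⟩⟩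

/-! ### The net with one free choice of `n` colours -/

/-- The net with a single transition, which consumes the token on the place `none`, initially of
colour `c₀`, and puts tokens of arbitrary colours on the `n` places `some i`. -/
noncomputable abbrev choiceNet (n : ℕ) (c₀ : C) : HLNet C where
  Var := Option (Fin n)
  Place := Option (Fin n)
  Trans := Unit
  finVar := inferInstance
  finPlace := inferInstance
  finTrans := inferInstance
  pre p v _ := open Classical in if p = none ∧ v = none then 1 else 0
  post _ v p := open Classical in if v = p ∧ p ≠ none then 1 else 0
  guard _ _ := True
  init := {fun p c => open Classical in if p = none ∧ c = c₀ then 1 else 0}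
  init_nonempty := Set.singleton_nonempty _
  init_same := by
    rintro M rfl M' rfl p
    rfl

/-- The initial marking of `choiceNet`. -/
noncomputable def choiceInit (n : ℕ) (c₀ : C) : (choiceNet n c₀).Marking :=
  fun p c => open Classical in if p = none ∧ c = c₀ then 1 else 0

variable {n : ℕ} {c₀ : C}

theorem choiceNet_one_le_pre {p v : Option (Fin n)} {t : Unit} :
    1 ≤ (choiceNet n c₀).pre p v t ↔ p = none ∧ v = none := by
  change 1 ≤ ite _ _ _ ↔ _
  split_ifs with h <;> simp [h]

theorem choiceNet_one_le_post {p v : Option (Fin n)} {t : Unit} :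
    1 ≤ (choiceNet n c₀).post t v p ↔ v = p ∧ p ≠ none := by
  change 1 ≤ ite _ _ _ ↔ _
  split_ifs with h <;> simp [h]

theorem choiceNet_exists_arc (v : Option (Fin n)) :
    ∃ p, 1 ≤ (choiceNet n c₀).pre p v () ∨ 1 ≤ (choiceNet n c₀).post () v p := by
  refine ⟨v, ?_⟩
  rw [choiceNet_one_le_pre, choiceNet_one_le_post]
  cases v <;> simp

/-- The variables of `choiceNet` as variables of its transition. -/
def choiceVar (c₀ : C) (v : Option (Fin n)) : (choiceNet n c₀).Vars () :=
  ⟨v, choiceNet_exists_arc v⟩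

theorem choiceNet_shallow : (choiceNet n c₀).Shallow := by
  intro t v p t' v' hpost hpre
  exact (choiceNet_one_le_post.1 hpost).2 (choiceNet_one_le_pre.1 hpre).1

open Classical in
-- Only the variable `none` labels an input arc, so the sum over variables has a single term.
theorem choiceNet_preMark (σ : (choiceNet n c₀).Vars () → C) (p : Option (Fin n)) (c : C) :
    (choiceNet n c₀).preMark () σ p c =
      if p = none ∧ c = σ (choiceVar c₀ none) then 1 else 0 := by
  unfold preMark
  rw [finsum_eq_single _ (choiceVar c₀ none)]
  · rw [finsum_eq_if]
    simp only [choiceVar, and_true]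
    split_ifs <;> grind
  · rintro ⟨v, hv⟩ hne
    rw [finsum_eq_if]
    have : v ≠ none := fun h => hne (Subtype.ext h)
    simp [this]

open Classical in
theorem choiceNet_postMark (σ : (choiceNet n c₀).Vars () → C) (p : Option (Fin n)) (c : C) :
    (choiceNet n c₀).postMark () σ p c =
      if p ≠ none ∧ c = σ (choiceVar c₀ p) then 1 else 0 := by
  unfold postMark
  rw [finsum_eq_single _ (choiceVar c₀ p)]
  · rw [finsum_eq_if]
    simp only [choiceVar, true_and]
    split_ifs <;> grind
  · rintro ⟨v, hv⟩ hne
    rw [finsum_eq_if]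
    have : v ≠ p := fun h => hne (Subtype.ext h)
    simp [this]

theorem finsum_le_one {α : Type*} {f : α → ℕ} (a : α) (h : ∀ x, x ≠ a → f x = 0) (ha : f a ≤ 1) :
    ∑ᶠ x, f x ≤ 1 := by
  rwa [finsum_eq_single f a h]

theorem choiceNet_ordinary : (choiceNet n c₀).Ordinary :=
  ⟨fun _ _ => finsum_le_one none (fun _ hv => if_neg fun h => hv h.2)
      (by dsimp only; split_ifs <;> simp),
    fun _ p => finsum_le_one p (fun _ hv => if_neg fun h => hv h.1)
      (by dsimp only; split_ifs <;> simp)⟩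

/-- The transition fires at most once: no arc refills the place `none`. -/
theorem choiceNet_reachable {M : (choiceNet n c₀).Marking} (h : (choiceNet n c₀).Reachable M) :
    M = choiceInit n c₀ ∨ ∃ σ, M = (choiceNet n c₀).postMark () σ := by
  induction h with
  | init M hM => exact Or.inl hM
  | step M M' t σ _ hfire ih =>
    have hle := hfire.1 none (σ.1 (choiceVar c₀ none))
    rw [choiceNet_preMark, if_pos ⟨rfl, rfl⟩] at hle
    right
    rcases ih with rfl | ⟨σ', rfl⟩
    · refine ⟨σ.1, ?_⟩
      have hc : σ.1 (choiceVar c₀ none) = c₀ := by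
        by_contra hne
        rw [choiceInit, if_neg fun h => hne h.2] at hle
        omega
      funext p c
      rw [hfire.2 p c, choiceNet_preMark, hc, choiceInit, Nat.sub_self, Nat.zero_add]
    · rw [choiceNet_postMark, if_neg fun h => h.1 rfl] at hle
      omega

theorem choiceNet_isNF [Finite C] : (choiceNet n c₀).IsNF where
  ordinary := choiceNet_ordinary
  safe M hM p := by
    rcases choiceNet_reachable hM with rfl | ⟨σ, rfl⟩
    · refine finsum_le_one c₀ (fun c hc => if_neg fun h => hc h.2) ?_
      unfold choiceInit
      split_ifs <;> simp
    · refine finsum_le_one (σ (choiceVar c₀ p)) (fun c hc => ?_) ?_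
      · rw [choiceNet_postMark, if_neg fun h => hc h.2]
      · rw [choiceNet_postMark]
        split_ifs <;> simp
  guards _ := letI := FirstOrder.Language.emptyStructure (M := C); Set.definable_univ
  finite_reachable := by
    refine ((Set.finite_singleton (choiceInit n c₀)).union
      (Set.finite_range ((choiceNet n c₀).postMark ()))).subset fun M hM => ?_
    rcases choiceNet_reachable hM with h | ⟨σ, h⟩
    · exact Or.inl h
    · exact Or.inr ⟨σ, h.symm⟩

/-! ### The symbolic unfolding of `choiceNet` -/

/-- The only event of the symbolic unfolding of `choiceNet`. -/
def choiceEvent (n : ℕ) (c₀ : C) : (choiceNet n c₀).Event := ⟨(), fun _ => Cond.init none⟩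

theorem choiceNet_initConds : (choiceNet n c₀).initConds = {Cond.init none} := by
  ext b
  constructor
  · rintro ⟨p, ⟨_, rfl, c, hc⟩, rfl⟩
    have hp : p = none := by
      by_contra hp
      simp [hp] at hc
    rw [hp]
    rfl
  · rintro rfl
    exact ⟨none, ⟨_, rfl, c₀, by simp⟩, rfl⟩

theorem choiceNet_initEvents : (choiceNet n c₀).initEvents = {choiceEvent n c₀} := by
  ext e
  constructor
  · rintro ⟨hinit, -⟩
    obtain ⟨⟨⟩, X⟩ := e
    have : X = fun _ => Cond.init none := funext fun a => by
      have := hinit a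
      rwa [choiceNet_initConds] at this
    rw [this]
    rfl
  · rintro rfl
    have hinit : ∀ a, (choiceEvent n c₀).pre a ∈ (choiceNet n c₀).initConds := fun a => by
      rw [choiceNet_initConds]
      rfl
    -- The constant valuation `c₀` agrees with the initial token and satisfies the trivial guard.
    refine ⟨hinit, fits_of_initConds hinit (fun a => (choiceNet_one_le_pre.1 a.2).1.symm)
      ⟨⟨fun _ => c₀, fun _ _ => c₀⟩, ⟨_, rfl, fun p c hc => ?_⟩, trivial, fun _ => rfl⟩⟩
    by_contra hne
    rw [if_neg fun h => hne h.2.symm] at hc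
    omega

theorem choiceNet_encard_produced :
    ((choiceNet n c₀).produced {choiceEvent n c₀}).encard = n := by
  let f : Fin n → (choiceNet n c₀).Cond := fun i =>
    (choiceEvent n c₀).out ⟨(some i, some i), choiceNet_one_le_post.2 ⟨rfl, Option.some_ne_none i⟩⟩
  have hf : Function.Injective f := fun i j hij => by
    have := congrArg Cond.label hij
    exact Option.some_injective _ this
  have hrange : (choiceNet n c₀).produced {choiceEvent n c₀} = Set.range f := by
    ext b
    constructor
    · rintro ⟨_, rfl, ⟨⟨v, p⟩, ha⟩, rfl⟩
      obtain ⟨hv, hp⟩ := choiceNet_one_le_post.1 ha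
      change v = p at hv
      obtain ⟨i, hi⟩ := Option.ne_none_iff_exists'.1 hp
      change p = some i at hi
      subst hv hi
      exact ⟨i, rfl⟩
    · rintro ⟨i, rfl⟩
      exact ⟨_, rfl, _, rfl⟩
  rw [hrange, ← Set.image_univ, hf.encard_image, Set.encard_univ, ENat.card_eq_coe_fintype_card,
    Fintype.card_fin]

theorem choiceNet_size :
    ((choiceNet n c₀).prefixOf (choiceNet n c₀).initEvents).size = ((1 + n + 1 : ℕ) : ℕ∞) := by
  have hdisj : Disjoint ((choiceNet n c₀).initConds)
      ((choiceNet n c₀).produced {choiceEvent n c₀}) := by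
    rw [Set.disjoint_left]
    rintro _ ⟨p, -, rfl⟩ ⟨_, -, a, ha⟩
    cases ha
  rw [choiceNet_initEvents]
  simp only [Prefix.size, prefixOf]
  rw [Set.encard_union_eq hdisj, choiceNet_encard_produced, choiceNet_initConds,
    Set.encard_singleton, Set.encard_singleton]
  push_cast
  rfl

/-! ### The expansion of `choiceNet` -/

/-- The firing mode of `choiceNet` that chooses the colours `f`. -/
def choiceMode (c₀ : C) (f : Fin n → C) : (choiceNet n c₀).Mode () :=
  ⟨fun v => v.1.elim c₀ f, trivial⟩

theorem choiceMode_injective : Function.Injective (choiceMode c₀ : (Fin n → C) → _) :=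
  fun _ _ h => funext fun i => congrFun (congrArg Subtype.val h) (choiceVar c₀ (some i))

theorem card_pow_le_encard_initEvents [Finite C] :
    ((Nat.card C ^ n : ℕ) : ℕ∞) ≤
      ((choiceNet n c₀).expansion (choiceInit n c₀)).initEvents.encard := by
  let F : (Fin n → C) → ((choiceNet n c₀).expansion (choiceInit n c₀)).Event := fun f =>
    ⟨⟨(), choiceMode c₀ f⟩, fun a => Cond.init a.1.1⟩
  -- All these events consume initial conditions according to the same rule; their transitions,
  -- which contain the mode, already distinguish them.
  have hF : Function.Injective F := fun _ _ h => choiceMode_injective <| by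
    have := congrArg Event.trans h
    exact eq_of_heq (Sigma.mk.inj this).2
  have hsub : Set.range F ⊆ ((choiceNet n c₀).expansion (choiceInit n c₀)).initEvents := by
    rintro _ ⟨f, rfl⟩
    refine expansion_mem_initEvents _ _ _ _ fun p c h => ?_
    rw [choiceNet_preMark] at h
    -- The chosen mode gives the variable `none` the value `c₀`, so its demand is exactly the
    -- initial marking.
    exact h
  refine le_trans (le_of_eq ?_) (Set.encard_le_encard hsub)
  rw [← Set.image_univ, hF.encard_image, Set.encard_univ, ENat.card_eq_coe_natCard, Nat.card_fun,
    Nat.card_fin]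

theorem card_pow_lt_size_expansion [Finite C] :
    ((Nat.card C ^ n : ℕ) : ℕ∞) < (((choiceNet n c₀).expansion (choiceInit n c₀)).prefixOf
      ((choiceNet n c₀).expansion (choiceInit n c₀)).initEvents).size := by
  set E := (choiceNet n c₀).expansion (choiceInit n c₀)
  -- One condition beyond the events makes the bound strict; for `n = 0` this is essential, since
  -- then `(m + 1) ^ n = m ^ n`.
  have hmem : (Cond.init (none, c₀) : E.Cond) ∈ (E.prefixOf E.initEvents).conds :=
    Or.inl ⟨(none, c₀), ⟨_, rfl, (), (if_pos ⟨rfl, rfl⟩ : choiceInit n c₀ none c₀ = 1).ge⟩, rfl⟩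
  have hone : 1 ≤ (E.prefixOf E.initEvents).conds.encard :=
    Set.one_le_encard_iff_nonempty.2 ⟨_, hmem⟩
  calc ((Nat.card C ^ n : ℕ) : ℕ∞) < 1 + ((Nat.card C ^ n : ℕ) : ℕ∞) := by
        exact_mod_cast Nat.lt_add_of_pos_left Nat.one_pos
    _ ≤ _ := add_le_add hone card_pow_le_encard_initEvents

end HLNet

end PetriUnf

theorem mainTheorem12 (n : ℕ) :
    ∃ (N : ∀ m : ℕ, PetriUnf.HLNet (Fin (m + 1))) (M₀ : ∀ m : ℕ, (N m).Marking),
      (∀ m : ℕ, 1 ≤ m → (N m).init = {M₀ m} ∧ (N m).IsNF) ∧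
      (∃ k : ℕ, ∀ m : ℕ, 1 ≤ m →
        (∃ r, (N m).IsAdequate r) ∧
        ∀ r, (N m).IsAdequate r →
          (N m).Terminates r ((N m).IsCutoff r) ∧
          (∃ β, (N m).IsOutput r ((N m).IsCutoff r) β) ∧
          ∀ β, (N m).IsOutput r ((N m).IsCutoff r) β → β.size = (k : ℕ∞)) ∧
      (∀ m : ℕ, 1 ≤ m →
        (∃ r, ((N m).expansion (M₀ m)).IsAdequatePT r) ∧
        ∀ r, ((N m).expansion (M₀ m)).IsAdequatePT r →
          ((N m).expansion (M₀ m)).Terminates r (((N m).expansion (M₀ m)).IsCutoffPT r) ∧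
          (∃ β, ((N m).expansion (M₀ m)).IsOutput r
            (((N m).expansion (M₀ m)).IsCutoffPT r) β) ∧
          ∀ β, ((N m).expansion (M₀ m)).IsOutput r
            (((N m).expansion (M₀ m)).IsCutoffPT r) β →
              ((m ^ n : ℕ) : ℕ∞) < β.size ∧ β.size < ⊤) := by
  open PetriUnf.HLNet in
  -- The constant `1 + n + 1` counts the initial condition, the `n` output conditions and the single
  -- event.
  refine ⟨fun m => choiceNet n (0 : Fin (m + 1)), fun m => choiceInit n 0,
    fun m _ => ⟨rfl, choiceNet_isNF⟩, ⟨1 + n + 1, fun m _ => ⟨⟨_, isAdequate_cardLT _⟩,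
      fun r hr => ⟨choiceNet_shallow.terminates _ _, choiceNet_shallow.exists_isOutput hr.wf _,
        fun β hβ => ?_⟩⟩⟩,
    fun m _ => ⟨⟨_, isAdequatePT_cardLT _⟩, fun r hr => ?_⟩⟩
  · rw [choiceNet_shallow.eq_of_isOutput hβ, choiceNet_size]
  · have hE := expansion_shallow choiceNet_shallow (choiceInit n (0 : Fin (m + 1)))
    refine ⟨hE.terminates _ _, hE.exists_isOutput hr.wf _, fun β hβ => ?_⟩
    rw [hE.eq_of_isOutput hβ]
    refine ⟨lt_of_le_of_lt ?_ card_pow_lt_size_expansion, size_prefixOf_initEvents_lt_top _⟩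
    rw [Nat.card_fin]
    exact_mod_cast Nat.pow_le_pow_left m.le_succ n
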